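/- Let $G_1$ and $G_2$ be finite groups. An irreducible representation of $G_1 \times G_2$ over a field is called \emph{unmixed} if it is the pullback, along one of the two projections $G_1 \times G_2 \to G_i$, of an irreducible representation of $G_i$; the other irreducible representations of $G_1 \times G_2$ are called \emph{mixed}. A representation of $G_1 \times G_2$ over a field of characteristic $0$ is \emph{mixed} if at least one of its irreducible factors is mixed. A subgroup $G_1 \times G_2$ of a finite group $G$ is \emph{universally mixed} in $G$ if for every representation $V$ of $G$ over an algebraically closed field of characteristic $0$, the restriction of $V$ to $G_1 \times G_2$ is either mixed or trivial (i.e. $G_1 \times G_2$ acts trivially on $V$). \textbf{Proposition.} Let $\ell \geq 2$ and $g_1, g_2 \geq 2$, and set $g = g_1 + g_2$. Then the block-diagonal subgroup $\mathrm{Sp}_{2g_1}(\mathbb{Z}/\ell) \times \mathrm{Sp}_{2g_2}(\mathbb{Z}/\ell)$ is universally mixed in $\mathrm{Sp}_{2g}(\mathbb{Z}/\ell)$. Moreover, for every representation $V$ of $\mathrm{Sp}_{2g}(\mathbb{Z}/\ell)$ over an arbitrary field of characteristic $0$, the restriction of $V$ to this subgroup is either mixed or trivial. -/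

import Mathlib

universe u v

/-- An irreducible representation of `G₁ × G₂` is unmixed if it is an irreducible representation
of `G₁` or of `G₂`, pulled back along the projection. -/
def Representation.IsUnmixedIrreducible {k G₁ G₂ W : Type*} [Field k] [Group G₁] [Group G₂]
    [AddCommGroup W] [Module k W] (σ : Representation k (G₁ × G₂) W) : Prop :=
  (∃ τ : Representation k G₁ W, τ.IsIrreducible ∧ σ = τ.comp (MonoidHom.fst G₁ G₂)) ∨
    (∃ τ : Representation k G₂ W, τ.IsIrreducible ∧ σ = τ.comp (MonoidHom.snd G₁ G₂))

/-- The mixed irreducible representations of `G₁ × G₂` are the irreducible representations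
that are not unmixed. -/
def Representation.IsMixedIrreducible {k G₁ G₂ W : Type*} [Field k] [Group G₁] [Group G₂]
    [AddCommGroup W] [Module k W] (σ : Representation k (G₁ × G₂) W) : Prop :=
  σ.IsIrreducible ∧ ¬ σ.IsUnmixedIrreducible

/-- A representation of `G₁ × G₂` is mixed if at least one of its irreducible factors is mixed.
For finite groups in characteristic zero all representations are semisimple, so the irreducible
factors are the irreducible subrepresentations. -/
def Representation.IsMixed {k G₁ G₂ V : Type*} [Field k] [Group G₁] [Group G₂]
    [AddCommGroup V] [Module k V] (σ : Representation k (G₁ × G₂) V) : Prop :=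
  ∃ W : Subrepresentation σ, W.toRepresentation.IsMixedIrreducible

/-- The subgroup `G₁ × G₂` of `G`, given by an injective homomorphism `ι`, is universally mixed
in `G`: for every representation of `G` over an algebraically closed field of characteristic
zero, the restriction to `G₁ × G₂` is either mixed or trivial. The universes of the field and of
the representation space are free parameters. -/
def IsUniversallyMixed.{a, b, w₁, w₂, w} {G₁ : Type w₁} {G₂ : Type w₂} {G : Type w}
    [Group G₁] [Group G₂] [Group G] (ι : G₁ × G₂ →* G) (_hι : Function.Injective ι) : Prop :=
  ∀ (k : Type a) [Field k] [IsAlgClosed k] [CharZero k]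
    (V : Type b) [AddCommGroup V] [Module k V] (ρ : Representation k G V),
    Representation.IsMixed (ρ.comp ι) ∨ Representation.IsTrivial (ρ.comp ι)

namespace SpProd

open Matrix

/-- The identification of index sets
`{a₁, …, a_m, b₁, …, b_m} ⊔ {a'₁, …, a'_n, b'₁, …, b'_n} ≃ {a₁, …, a_{m+n}, b₁, …, b_{m+n}}`
sending `a_i ↦ a_i`, `b_i ↦ b_i`, `a'_i ↦ a_{m+i}`, `b'_i ↦ b_{m+i}`. -/
def indexEquiv (m n : ℕ) :
    (Fin m ⊕ Fin m) ⊕ (Fin n ⊕ Fin n) ≃ Fin (m + n) ⊕ Fin (m + n) :=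
  (Equiv.sumSumSumComm (Fin m) (Fin m) (Fin n) (Fin n)).trans
    (Equiv.sumCongr finSumFinEquiv finSumFinEquiv)

/-- The block-diagonal matrix `A ⊕ B`, written in the symplectic basis of `R ^ (2 (m + n))`. -/
def blockSum {R : Type*} [CommRing R] {m n : ℕ}
    (A : Matrix (Fin m ⊕ Fin m) (Fin m ⊕ Fin m) R)
    (B : Matrix (Fin n ⊕ Fin n) (Fin n ⊕ Fin n) R) :
    Matrix (Fin (m + n) ⊕ Fin (m + n)) (Fin (m + n) ⊕ Fin (m + n)) R :=
  Matrix.reindex (indexEquiv m n) (indexEquiv m n) (Matrix.fromBlocks A 0 0 B)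

theorem blockSum_mul {R : Type*} [CommRing R] {m n : ℕ}
    (A A' : Matrix (Fin m ⊕ Fin m) (Fin m ⊕ Fin m) R)
    (B B' : Matrix (Fin n ⊕ Fin n) (Fin n ⊕ Fin n) R) :
    blockSum (A * A') (B * B') = blockSum A B * blockSum A' B' := by
  simp [blockSum, Matrix.submatrix_mul_equiv, Matrix.fromBlocks_multiply]

theorem blockSum_one {R : Type*} [CommRing R] {m n : ℕ} :
    blockSum (R := R) (1 : Matrix (Fin m ⊕ Fin m) (Fin m ⊕ Fin m) R)
      (1 : Matrix (Fin n ⊕ Fin n) (Fin n ⊕ Fin n) R) = 1 := by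
  simp [blockSum]

theorem blockSum_transpose {R : Type*} [CommRing R] {m n : ℕ}
    (A : Matrix (Fin m ⊕ Fin m) (Fin m ⊕ Fin m) R)
    (B : Matrix (Fin n ⊕ Fin n) (Fin n ⊕ Fin n) R) :
    (blockSum A B)ᵀ = blockSum Aᵀ Bᵀ := by
  simp [blockSum, Matrix.fromBlocks_transpose]

theorem blockSum_J {R : Type*} [CommRing R] {m n : ℕ} :
    blockSum (J (Fin m) R) (J (Fin n) R) = J (Fin (m + n)) R := by
  rw [blockSum, ← Equiv.eq_symm_apply]
  ext i j
  rcases i with (i | i) | (i | i) <;> rcases j with (j | j) | (j | j) <;>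
    simp [indexEquiv, J, Matrix.one_apply, Fin.ext_iff] <;> lia

theorem blockSum_injective {R : Type*} [CommRing R] {m n : ℕ}
    {A A' : Matrix (Fin m ⊕ Fin m) (Fin m ⊕ Fin m) R}
    {B B' : Matrix (Fin n ⊕ Fin n) (Fin n ⊕ Fin n) R}
    (h : blockSum A B = blockSum A' B') : A = A' ∧ B = B' := by
  have h' := (Matrix.reindex (indexEquiv m n) (indexEquiv m n)).injective h
  rw [Matrix.fromBlocks_inj] at h'
  exact ⟨h'.1, h'.2.2.2⟩

/-- The standard block-diagonal embedding `Sp_{2m}(R) × Sp_{2n}(R) → Sp_{2(m+n)}(R)`. -/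
def embedding (R : Type*) [CommRing R] (m n : ℕ) :
    symplecticGroup (Fin m) R × symplecticGroup (Fin n) R →* symplecticGroup (Fin (m + n)) R where
  toFun p := ⟨blockSum p.1.1 p.2.1, by
    rw [SymplecticGroup.mem_iff, ← blockSum_J, blockSum_transpose, ← blockSum_mul,
      ← blockSum_mul, SymplecticGroup.mem_iff.mp p.1.2, SymplecticGroup.mem_iff.mp p.2.2]⟩
  map_one' := Subtype.ext blockSum_one
  map_mul' p q := Subtype.ext (blockSum_mul p.1.1 q.1.1 p.2.1 q.2.1)

theorem embedding_injective (R : Type*) [CommRing R] (m n : ℕ) :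
    Function.Injective (embedding R m n) := by
  intro p q h
  obtain ⟨h₁, h₂⟩ := blockSum_injective (Subtype.ext_iff.mp h)
  exact Prod.ext (Subtype.ext h₁) (Subtype.ext h₂)

end SpProd

/-! If the restriction is not mixed, every irreducible factor is trivial on one of the two blocks.
Hence, by semisimplicity, `(ρ s - 1) * (ρ t - 1) = 0` for `s`, `t` in different blocks.

Apply this to transvections. Write `T_v` for `x ↦ x + ω(v, x) v`, take `c` in the first block and
orthogonal `a`, `b` in the second, and put `X = ρ(T_c) - 1`. Then `T_a`, `T_b`, `T_{a+b}` act on `X`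
as the identity. A shear fixing `c` and moving `a` to `a + c` conjugates this to `T_{a+c}`; the same
works for `b` and `a + b`. On an isotropic span `v ↦ T_v` is quadratic, so `T_{a+b+c} T_a T_b T_c =
T_{a+b} T_{a+c} T_{b+c}`. Multiplied by `X`, this leaves `X ρ(T_c) = X`, that is `X² = 0`. An
operator of finite order in characteristic zero with this property is the identity, so `T_c` lies in
the kernel (`map_transvection_eq_one`).

Finally, a normal subgroup of `Sp(ℤ/l)` containing the transvections along one basis vector is
everything (`normal_eq_top_of_transvection_mem`): stable range one makes it transitive on hyperbolic
pairs. So the whole representation is trivial. -/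

/-! ### Representations without mixed factors -/

namespace Subrepresentation

open scoped MonoidAlgebra

/-- A simple submodule of the module attached to a representation is an irreducible
subrepresentation. -/
theorem isIrreducible_toRepresentation_ofSubmodule' {k G V : Type*} [Field k] [Group G]
    [AddCommGroup V] [Module k V] {σ : Representation k G V}
    (S : Submodule k[G] σ.asModule) (hS : IsSimpleModule k[G] S) :
    (ofSubmodule' S).toRepresentation.IsIrreducible := by
  have hatom : IsAtom S := isSimpleModule_iff_isAtom.mp hS
  set W := ofSubmodule' S with hW
  refine { exists_pair_ne := ⟨⊥, ⊤, fun h => hatom.1 ?_⟩, eq_bot_or_eq_top := fun U => ?_ }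
  · refine (Submodule.eq_bot_iff _).mpr fun x hx => ?_
    have h1 : (⟨x, hx⟩ : W.toSubmodule) ∈
        (⊤ : Subrepresentation W.toRepresentation).toSubmodule := Submodule.mem_top
    rw [← h] at h1
    exact congrArg Subtype.val ((Submodule.mem_bot k).mp h1)
  · let U' : Subrepresentation σ :=
      { toSubmodule := U.toSubmodule.map W.toSubmodule.subtype
        apply_mem_toSubmodule := by
          rintro g _ ⟨y, hy, rfl⟩
          exact ⟨W.toRepresentation g y, U.apply_mem_toSubmodule g hy, rfl⟩ }
    have hle : asSubmodule U' ≤ S := by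
      rintro _ ⟨y, -, rfl⟩
      exact y.2
    rcases hatom.le_iff.mp hle with h | h
    · left
      refine toSubmodule_injective ((Submodule.eq_bot_iff _).mpr fun y hy => Subtype.ext ?_)
      have : (y : V) ∈ asSubmodule U' := ⟨y, hy, rfl⟩
      rw [h] at this
      exact this
    · right
      refine toSubmodule_injective (Submodule.eq_top_iff'.mpr fun y => ?_)
      have : (y : V) ∈ asSubmodule U' := by
        rw [h]
        exact y.2
      obtain ⟨z, hz, hzy⟩ := this
      rwa [← Subtype.ext hzy]

end Subrepresentation

namespace Representation

open scoped MonoidAlgebra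

/-- If no irreducible factor of a representation of a finite group `G₁ × G₂` is mixed, then
the operators `a - 1` and `b - 1` annihilate each other for all `a ∈ G₁`, `b ∈ G₂`. -/
theorem sub_one_mul_sub_one_eq_zero_of_not_isMixed {k G₁ G₂ V : Type*} [Field k] [CharZero k]
    [Group G₁] [Group G₂] [Finite G₁] [Finite G₂] [AddCommGroup V] [Module k V]
    {σ : Representation k (G₁ × G₂) V} (h : ¬ σ.IsMixed) (a : G₁) (b : G₂) :
    (σ (a, 1) - 1) * (σ (1, b) - 1) = 0 := by
  -- The invertible group order is what Maschke's theorem needs; no finiteness of `V` enters.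
  have : NeZero (Nat.card (G₁ × G₂) : k) := ⟨Nat.cast_ne_zero.mpr Nat.card_pos.ne'⟩
  have hcomm : (σ (a, 1) - 1) * (σ (1, b) - 1) = (σ (1, b) - 1) * (σ (a, 1) - 1) := by
    simp only [sub_mul, mul_sub, ← map_mul, one_mul, mul_one, Prod.mk_mul_mk]
    abel
  have hss : IsSemisimpleModule k[G₁ × G₂] σ.asModule :=
    (isSemisimpleRepresentation_iff_isSemisimpleModule_asModule σ).mp inferInstance
  have htop := IsSemisimpleModule.sSup_simples_eq_top k[G₁ × G₂] σ.asModule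
  have hsimple : ∀ S : Submodule k[G₁ × G₂] σ.asModule, IsSimpleModule k[G₁ × G₂] S →
      ∀ x : V, x ∈ Subrepresentation.ofSubmodule' S →
        ((σ (a, 1) - 1) * (σ (1, b) - 1)) x = 0 := by
    intro S hS x hx
    have hirr := Subrepresentation.isIrreducible_toRepresentation_ofSubmodule' S hS
    have hun : (Subrepresentation.ofSubmodule' S).toRepresentation.IsUnmixedIrreducible := by
      by_contra hc
      exact h ⟨_, hirr, hc⟩
    rcases hun with ⟨τ, -, hτ⟩ | ⟨τ, -, hτ⟩
    · have h1 := LinearMap.congr_fun (DFunLike.congr_fun hτ (1, b)) ⟨x, hx⟩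
      rw [MonoidHom.comp_apply, MonoidHom.coe_fst, map_one, Module.End.one_apply] at h1
      have h2 : σ (1, b) x = x := congrArg Subtype.val h1
      simp [h2]
    · have h1 := LinearMap.congr_fun (DFunLike.congr_fun hτ (a, 1)) ⟨x, hx⟩
      rw [MonoidHom.comp_apply, MonoidHom.coe_snd, map_one, Module.End.one_apply] at h1
      have h2 : σ (a, 1) x = x := congrArg Subtype.val h1
      rw [hcomm]
      simp [h2]
  have hall : ∀ x : σ.asModule,
      ((σ (a, 1) - 1) * (σ (1, b) - 1)) (σ.asModuleEquiv x) = 0 := by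
    intro x
    have hx : x ∈ sSup {m : Submodule k[G₁ × G₂] σ.asModule | IsSimpleModule k[G₁ × G₂] m} := by
      rw [htop]
      exact Submodule.mem_top
    rw [sSup_eq_iSup'] at hx
    refine Submodule.iSup_induction _ (motive := fun x : σ.asModule =>
      ((σ (a, 1) - 1) * (σ (1, b) - 1)) (σ.asModuleEquiv x) = 0) hx ?_ ?_ ?_
    · rintro ⟨S, hS⟩ y hy
      exact hsimple S hS y hy
    · rw [map_zero, map_zero]
    · intro y z hy hz
      rw [map_add, map_add, hy, hz, add_zero]
  exact LinearMap.ext fun v => hall v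

end Representation

/-- Over a field of characteristic zero, a unipotent operator of finite order is trivial if
`(x - 1) ^ 2 = 0`. -/
theorem eq_one_of_sub_one_mul_self_eq_zero {k A : Type*} [Field k] [CharZero k] [Ring A]
    [Algebra k A] {x : A} {n : ℕ} (hn : n ≠ 0) (hx : x ^ n = 1)
    (h : (x - 1) * (x - 1) = 0) : x = 1 := by
  have key : ∀ m : ℕ, x ^ m = 1 + (m : k) • (x - 1) := by
    intro m
    induction m with
    | zero => simp
    | succ m ih =>
      have : x ^ m * x = x ^ m * (x - 1) + x ^ m := by rw [mul_sub, mul_one, sub_add_cancel]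
      rw [pow_succ, this, ih, add_mul, smul_mul_assoc, h]
      push_cast
      rw [add_smul]
      simp
      abel
  have h1 := key n
  rw [hx, left_eq_add, smul_eq_zero, Nat.cast_eq_zero] at h1
  exact sub_eq_zero.mp (h1.resolve_left hn)

/-! ### Stable range of `ℤ/l` -/

namespace ZMod

/-- The ring `ℤ/l` has stable range one. -/
theorem exists_isUnit_add_mul {l : ℕ} [NeZero l] {p q a b : ZMod l} (h : a * p + b * q = 1) :
    ∃ c, IsUnit (p + c * q) := by
  -- With `c` the product of the primes dividing `l` but not `p`, each prime divisor of `l` divides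
  -- exactly one of `p` and `c * q`.
  let ps : Finset ℕ := {r ∈ l.primeFactors | ¬ r ∣ p.val}
  refine ⟨(ps.prod id : ℕ), ?_⟩
  have hcast : p + (ps.prod id : ℕ) * q = ((p.val + ps.prod id * q.val : ℕ) : ZMod l) := by
    push_cast
    simp
  rw [hcast, ZMod.isUnit_iff_coprime]
  refine Nat.coprime_of_dvd fun r hr hd hrl => ?_
  by_cases hrp : r ∣ p.val
  · rcases hr.dvd_mul.mp ((Nat.dvd_add_right hrp).mp hd) with h1 | h1
    · obtain ⟨s, hs, hrs⟩ := (hr.prime.dvd_finsetProd_iff id).mp h1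
      rw [Finset.mem_filter, Nat.mem_primeFactors] at hs
      rw [(Nat.prime_dvd_prime_iff_eq hr hs.1.1).mp hrs] at hrp
      exact hs.2 hrp
    · have : Fact r.Prime := ⟨hr⟩
      have h2 := congrArg (ZMod.castHom hrl (ZMod r)) h
      have hp : ZMod.castHom hrl (ZMod r) p = 0 := by
        rw [← ZMod.natCast_zmod_val p, map_natCast]
        exact (ZMod.natCast_eq_zero_iff _ _).mpr hrp
      have hq : ZMod.castHom hrl (ZMod r) q = 0 := by
        rw [← ZMod.natCast_zmod_val q, map_natCast]
        exact (ZMod.natCast_eq_zero_iff _ _).mpr h1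
      rw [map_add, map_mul, map_mul, hp, hq, map_one, mul_zero, mul_zero, add_zero] at h2
      exact zero_ne_one h2
  · have hmem : r ∈ ps := Finset.mem_filter.mpr
      ⟨Nat.mem_primeFactors.mpr ⟨hr, hrl, NeZero.ne l⟩, hrp⟩
    exact hrp ((Nat.dvd_add_left ((Finset.dvd_prod_of_mem id hmem).mul_right _)).mp hd)

/-- Stable range one is used twice: once to find `s` with `q + s * (a * p + r)` a unit, which makes
the pair `p`, `q + s * r` unimodular, and once on that pair. -/
theorem exists_isUnit_add_mul_add_mul {l : ℕ} [NeZero l] {p q r a b : ZMod l}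
    (h : a * p + b * q + r = 1) : ∃ s c, IsUnit (p + c * (q + s * r)) := by
  obtain ⟨s, hs⟩ := exists_isUnit_add_mul (p := q) (q := a * p + r) (a := b) (b := 1)
    (by linear_combination h)
  obtain ⟨w, hw⟩ := hs.exists_left_inv
  obtain ⟨c, hc⟩ := exists_isUnit_add_mul (p := p) (q := q + s * r) (a := w * (s * a)) (b := w)
    (by linear_combination hw)
  exact ⟨s, c, hc⟩

end ZMod

/-! ### The symplectic form and transvections -/

namespace SymplecticGroup

open Matrix

variable {n R : Type*} [Fintype n] [CommRing R]

/-- The standard symplectic form on `R ^ (2n)`. -/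
def form (x y : n ⊕ n → R) : R :=
  ∑ i, (x (Sum.inr i) * y (Sum.inl i) - x (Sum.inl i) * y (Sum.inr i))

theorem form_add_left (x y z : n ⊕ n → R) : form (x + y) z = form x z + form y z := by
  simp only [form, Pi.add_apply, ← Finset.sum_add_distrib]
  exact Finset.sum_congr rfl fun _ _ => by ring

theorem form_smul_left (c : R) (x z : n ⊕ n → R) : form (c • x) z = c * form x z := by
  simp only [form, Pi.smul_apply, smul_eq_mul, Finset.mul_sum]
  exact Finset.sum_congr rfl fun _ _ => by ring

theorem form_swap (x y : n ⊕ n → R) : form x y = - form y x := by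
  simp only [form, ← Finset.sum_neg_distrib]
  exact Finset.sum_congr rfl fun _ _ => by ring

theorem form_self (x : n ⊕ n → R) : form x x = 0 :=
  Finset.sum_eq_zero fun _ _ => by ring

theorem form_add_right (x y z : n ⊕ n → R) : form x (y + z) = form x y + form x z := by
  rw [form_swap, form_add_left, form_swap y, form_swap z]
  ring

theorem form_smul_right (c : R) (x z : n ⊕ n → R) : form x (c • z) = c * form x z := by
  rw [form_swap, form_smul_left, form_swap z]
  ring

theorem form_sub_left (x y z : n ⊕ n → R) : form (x - y) z = form x z - form y z := by
  rw [eq_sub_iff_add_eq, ← form_add_left, sub_add_cancel]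

variable [DecidableEq n]

theorem form_eq_dotProduct (x y : n ⊕ n → R) : form x y = x ⬝ᵥ (J n R *ᵥ y) := by
  simp [form, J, dotProduct, Fintype.sum_sum_type, fromBlocks_mulVec, Matrix.neg_mulVec,
    Finset.sum_sub_distrib]
  ring

theorem mem_iff_form {A : Matrix (n ⊕ n) (n ⊕ n) R} :
    A ∈ symplecticGroup n R ↔ ∀ x y, form (A *ᵥ x) (A *ᵥ y) = form x y := by
  have key : ∀ x y, form (A *ᵥ x) (A *ᵥ y) = x ⬝ᵥ ((Aᵀ * J n R * A) *ᵥ y) := by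
    intro x y
    rw [form_eq_dotProduct, ← mulVec_mulVec, ← mulVec_mulVec, dotProduct_mulVec x,
      vecMul_transpose]
  rw [mem_iff']
  constructor
  · intro h x y
    rw [key, h, form_eq_dotProduct]
  · intro h
    ext i j
    have := h (Pi.single i 1) (Pi.single j 1)
    rw [key, form_eq_dotProduct] at this
    simpa using this

theorem form_mulVec (A : symplecticGroup n R) (x y : n ⊕ n → R) :
    form (A.1 *ᵥ x) (A.1 *ᵥ y) = form x y :=
  mem_iff_form.mp A.2 x y

theorem ext_mulVec {A B : symplecticGroup n R} (h : ∀ x, A.1 *ᵥ x = B.1 *ᵥ x) : A = B :=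
  Subtype.ext (Matrix.ext_of_mulVec_single fun _ => h _)

/-- The symplectic transvection `x ↦ x + c ω(v, x) v`. -/
def transvection (v : n ⊕ n → R) (c : R) : symplecticGroup n R :=
  ⟨1 + c • vecMulVec v (v ᵥ* J n R), by
    rw [mem_iff_form]
    intro x y
    have key : ∀ x, (1 + c • vecMulVec v (v ᵥ* J n R)) *ᵥ x = x + (c * form v x) • v := by
      intro x
      rw [add_mulVec, one_mulVec, smul_mulVec, vecMulVec_mulVec, form_eq_dotProduct,
        dotProduct_mulVec, mul_smul]
      simp
    simp only [key, form_add_left, form_add_right, form_smul_left, form_smul_right, form_self]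
    rw [form_swap x v]
    ring⟩

theorem transvection_mulVec (v : n ⊕ n → R) (c : R) (x : n ⊕ n → R) :
    (transvection v c).1 *ᵥ x = x + (c * form v x) • v := by
  rw [transvection, add_mulVec, one_mulVec, smul_mulVec, vecMulVec_mulVec, form_eq_dotProduct,
    dotProduct_mulVec, mul_smul]
  simp

theorem mul_mulVec (A B : symplecticGroup n R) (x : n ⊕ n → R) :
    (A * B).1 *ᵥ x = A.1 *ᵥ (B.1 *ᵥ x) := by
  rw [mulVec_mulVec]
  rfl

theorem one_mulVec' (x : n ⊕ n → R) : (1 : symplecticGroup n R).1 *ᵥ x = x :=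
  one_mulVec x

theorem transvection_add (v : n ⊕ n → R) (c d : R) :
    transvection v (c + d) = transvection v c * transvection v d := by
  refine ext_mulVec fun x => ?_
  simp only [mul_mulVec, transvection_mulVec, form_add_right, form_smul_right, form_self]
  module

theorem transvection_zero (v : n ⊕ n → R) : transvection v 0 = 1 :=
  ext_mulVec fun x => by simp [transvection_mulVec]

theorem transvection_natCast (v : n ⊕ n → R) (m : ℕ) :
    transvection v (m : R) = transvection v 1 ^ m := by
  induction m with
  | zero => simp [transvection_zero]
  | succ m ih => rw [Nat.cast_succ, transvection_add, ih, pow_succ]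

theorem transvection_conj (A : symplecticGroup n R) (v : n ⊕ n → R) (c : R) :
    A * transvection v c * A⁻¹ = transvection (A.1 *ᵥ v) c := by
  rw [mul_inv_eq_iff_eq_mul]
  refine ext_mulVec fun x => ?_
  simp only [mul_mulVec, transvection_mulVec, form_mulVec, mulVec_add, mulVec_smul]

/-- The polarization relation between the transvections along three pairwise orthogonal
vectors and their sums. -/
theorem transvection_relation {a b c : n ⊕ n → R} (hab : form a b = 0) (hac : form a c = 0)
    (hbc : form b c = 0) :
    transvection (a + b + c) 1 * transvection a 1 * transvection b 1 * transvection c 1 =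
      transvection (a + b) 1 * transvection (a + c) 1 * transvection (b + c) 1 := by
  -- By orthogonality the rank-one parts `x ↦ ω(v, x) v` multiply to zero, so products of
  -- transvections add them. What remains is the identity satisfied by every quadratic map.
  refine ext_mulVec fun x => ?_
  have hba : form b a = 0 := by rw [form_swap, hab, neg_zero]
  have hca : form c a = 0 := by rw [form_swap, hac, neg_zero]
  have hcb : form c b = 0 := by rw [form_swap, hbc, neg_zero]
  simp only [mul_mulVec, transvection_mulVec, form_add_right, form_smul_right, form_add_left,
    form_self, hab, hac, hbc, hba, hca, hcb]
  module

/-- If `ω(x, y) = 1`, the transvection along `x - y` carries `x` to `y`. -/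
theorem transvection_sub_mulVec {x y : n ⊕ n → R} (h : form x y = 1) :
    (transvection (x - y) (-1)).1 *ᵥ x = y := by
  rw [transvection_mulVec, form_sub_left, form_self, form_swap y, h]
  module

/-! ### Normal subgroups containing transvections -/

section NormalSubgroup

variable {N : Subgroup (symplecticGroup n R)}

/-- A normal subgroup containing the transvections along `x` contains those along every `y`
with `ω(x, y) = 1`. -/
theorem transvection_mem_of_form_eq_one [N.Normal] {x y : n ⊕ n → R}
    (hx : ∀ c, transvection x c ∈ N) (h : form x y = 1) (c : R) : transvection y c ∈ N := by
  rw [← transvection_sub_mulVec h, ← transvection_conj]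
  exact Subgroup.Normal.conj_mem inferInstance _ (hx c) _

theorem transvection_mem_of_form_eq_one' [N.Normal] {x y : n ⊕ n → R}
    (hx : ∀ c, transvection x c ∈ N) (h : form y x = 1) (c : R) : transvection y c ∈ N := by
  have hneg : transvection (-y) c = transvection y c := ext_mulVec fun z => by
    rw [transvection_mulVec, transvection_mulVec, ← neg_one_smul R y, form_smul_left]
    module
  rw [← hneg]
  refine transvection_mem_of_form_eq_one hx ?_ c
  rw [← neg_one_smul R y, form_smul_right, form_swap, h]
  ring

theorem transvection_mulVec_of_form_eq_zero {u z : n ⊕ n → R} (h : form u z = 0) (c : R) :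
    (transvection u c).1 *ᵥ z = z := by
  rw [transvection_mulVec, h]
  simp

end NormalSubgroup

/-- Let `W` be a set of vectors, and let `(e, f)` and `(v, w)` be hyperbolic pairs orthogonal to
`W`. A normal subgroup of `Sp(ℤ/l)` that contains the transvections along `e` and `f` has an
element that fixes `W` pointwise and carries `(v, w)` to `(e, f)`. -/
theorem exists_mem_mulVec_eq {l : ℕ} [NeZero l] {N : Subgroup (symplecticGroup n (ZMod l))}
    [N.Normal] {W : Set (n ⊕ n → ZMod l)} {e f v w : n ⊕ n → ZMod l}
    (heN : ∀ c, transvection e c ∈ N) (hef : form e f = 1) (hvw : form v w = 1)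
    (he : ∀ z ∈ W, form e z = 0) (hf : ∀ z ∈ W, form f z = 0)
    (hv : ∀ z ∈ W, form v z = 0) (hw : ∀ z ∈ W, form w z = 0) :
    ∃ h ∈ N, (∀ z ∈ W, h.1 *ᵥ z = z) ∧ h.1 *ᵥ v = e ∧ h.1 *ᵥ w = f := by
  have hfN := transvection_mem_of_form_eq_one heN hef
  have hfe : form f e = -1 := by rw [form_swap, hef]
  -- `y` is the component of `w` orthogonal to the plane of `e` and `f`.
  have hdecomp : ∃ y, w = form w f • e + form e w • f + y :=
    ⟨w - (form w f • e + form e w • f), by abel⟩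
  obtain ⟨y, hy⟩ := hdecomp
  have hyf : form y f = 0 := by
    have := congrArg (fun t => form t f) hy
    simp only [form_add_left, form_smul_left, hef, form_self] at this
    linear_combination -this
  have hyW : ∀ z ∈ W, form y z = 0 := by
    intro z hz
    have := congrArg (fun t => form t z) hy
    simp only [form_add_left, form_smul_left, he z hz, hf z hz, hw z hz] at this
    linear_combination -this
  have carry_of_form_eq_one : ∀ x, (∀ z ∈ W, form x z = 0) → form x e = 1 →
      ∃ h ∈ N, (∀ z ∈ W, h.1 *ᵥ z = z) ∧ h.1 *ᵥ x = e := by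
    intro x hx hxe
    refine ⟨transvection (x - e) (-1), transvection_mem_of_form_eq_one' heN ?_ _,
      fun z hz => transvection_mulVec_of_form_eq_zero ?_ _, transvection_sub_mulVec hxe⟩
    · rw [form_sub_left, hxe, form_self, sub_zero]
    · rw [form_sub_left, hx z hz, he z hz, sub_zero]
  have carry_of_isUnit : ∀ x, (∀ z ∈ W, form x z = 0) → IsUnit (form x f) →
      ∃ h ∈ N, (∀ z ∈ W, h.1 *ᵥ z = z) ∧ h.1 *ᵥ x = e := by
    intro x hx hxf
    obtain ⟨t, ht⟩ := hxf.exists_left_inv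
    -- The coefficient is chosen so that a transvection along `f` changes `ω(x, e)` to `1`.
    obtain ⟨h, hhN, hhW, hh⟩ := carry_of_form_eq_one
      ((transvection f ((1 - form x e) * t)).1 *ᵥ x)
      (fun z hz => by
        rw [transvection_mulVec, form_add_left, form_smul_left, hx z hz, hf z hz]
        ring)
      (by
        rw [transvection_mulVec, form_add_left, form_smul_left, hfe, form_swap f x]
        linear_combination (1 - form x e) * ht)
    exact ⟨h * transvection f ((1 - form x e) * t), N.mul_mem hhN (hfN _),
      fun z hz => by
        rw [mul_mulVec, transvection_mulVec_of_form_eq_zero (hf z hz), hhW z hz],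
      by rw [mul_mulVec, hh]⟩
  have carry_snd : ∀ x, (∀ z ∈ W, form x z = 0) → form e x = 1 →
      ∃ h ∈ N, (∀ z ∈ W, h.1 *ᵥ z = z) ∧ h.1 *ᵥ e = e ∧ h.1 *ᵥ x = f := by
    intro x hx hex
    -- A transvection along `e` makes `ω(x', f) = 1`; then `x' - f` is orthogonal to `e`, so moving
    -- `x'` to `f` does not disturb `e`.
    set x' := x + (1 - form x f) • e with hx'
    have htx : (transvection e (1 - form x f)).1 *ᵥ x = x' := by
      rw [transvection_mulVec, hex, mul_one]
    have hx'f : form x' f = 1 := by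
      rw [hx', form_add_left, form_smul_left, hef]
      ring
    have hx'e : form x' e = -1 := by
      rw [hx', form_add_left, form_smul_left, form_self, form_swap x, hex]
      ring
    refine ⟨transvection (x' - f) (-1) * transvection e (1 - form x f),
      N.mul_mem (transvection_mem_of_form_eq_one' hfN ?_ _) (heN _), fun z hz => ?_, ?_, ?_⟩
    · rw [form_sub_left, hx'f, form_self, sub_zero]
    · rw [mul_mulVec, transvection_mulVec_of_form_eq_zero (he z hz),
        transvection_mulVec_of_form_eq_zero]
      rw [form_sub_left, hx', form_add_left, form_smul_left, hx z hz, he z hz, hf z hz]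
      ring
    · rw [mul_mulVec, transvection_mulVec_of_form_eq_zero (form_self e),
        transvection_mulVec_of_form_eq_zero]
      rw [form_sub_left, hx'e, hfe, sub_self]
    · rw [mul_mulVec, htx, transvection_sub_mulVec hx'f]
  -- Pairing the decomposition of `w` with `v` shows that `ω(v, f)`, `ω(v, e)`, `ω(v, y)` are
  -- unimodular.
  have hunim : form e w * form v f + form w f * form v e + form v y = 1 := by
    have := congrArg (fun t => form v t) hy
    simp only [form_add_right, form_smul_right, hvw] at this
    linear_combination -this
  obtain ⟨s, c, hsc⟩ := ZMod.exists_isUnit_add_mul_add_mul hunim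
  have huf : form (e + s • y) f = 1 := by
    rw [form_add_left, form_smul_left, hef, hyf]
    ring
  have huW : ∀ z ∈ W, form (e + s • y) z = 0 := by
    intro z hz
    rw [form_add_left, form_smul_left, he z hz, hyW z hz]
    ring
  -- Since `ω(e + s y, f) = 1`, this lies in `N`, and it turns `ω(v, f)` into the unit `ω(v, f) + c
  -- (ω(v, e) + s ω(v, y))`.
  set t := transvection (e + s • y) (-c) with ht
  have htN : t ∈ N := transvection_mem_of_form_eq_one' hfN huf _
  have htW : ∀ z ∈ W, t.1 *ᵥ z = z := fun z hz =>
    transvection_mulVec_of_form_eq_zero (huW z hz) _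
  obtain ⟨h₁, hh₁N, hh₁W, hh₁⟩ := carry_of_isUnit (t.1 *ᵥ v)
    (fun z hz => by rw [← htW z hz, form_mulVec, hv z hz])
    (by
      convert hsc using 1
      rw [ht, transvection_mulVec, form_add_left, form_smul_left, huf, form_swap _ v,
        form_add_right, form_smul_right]
      ring)
  have hgW : ∀ z ∈ W, (h₁ * t).1 *ᵥ z = z := fun z hz => by
    rw [mul_mulVec, htW z hz, hh₁W z hz]
  have hgv : (h₁ * t).1 *ᵥ v = e := by rw [mul_mulVec, hh₁]
  obtain ⟨h₂, hh₂N, hh₂W, hh₂e, hh₂f⟩ := carry_snd ((h₁ * t).1 *ᵥ w)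
    (fun z hz => by rw [← hgW z hz, form_mulVec, hw z hz])
    (by rw [← hgv, form_mulVec, hvw])
  exact ⟨h₂ * (h₁ * t), N.mul_mem hh₂N (N.mul_mem hh₁N htN),
    fun z hz => by rw [mul_mulVec, hgW z hz, hh₂W z hz],
    by rw [mul_mulVec, hgv, hh₂e], by rw [mul_mulVec, hh₂f]⟩

theorem form_single_inl (i : n) (x : n ⊕ n → R) :
    form (Pi.single (Sum.inl i) 1) x = - x (Sum.inr i) := by
  simp [form, Pi.single_apply]

theorem form_single_inr (i : n) (x : n ⊕ n → R) :
    form (Pi.single (Sum.inr i) 1) x = x (Sum.inl i) := by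
  simp [form, Pi.single_apply]

/-- Write `e_i`, `f_i` for the `inl` and `inr` basis vectors. Consecutive vectors in the chain
`e_{i₀}`, `f_{i₀}`, `e_{i₀} + e_i`, `f_i` pair to `±1`, so membership in `N` passes along it. -/
theorem transvection_single_inr_mem {N : Subgroup (symplecticGroup n R)} [N.Normal] {i₀ : n}
    (h : ∀ c, transvection (Pi.single (Sum.inl i₀) (1 : R)) c ∈ N) (i : n) (c : R) :
    transvection (Pi.single (Sum.inr i) (1 : R)) c ∈ N := by
  have h₀ : ∀ c, transvection (Pi.single (Sum.inr i₀) (1 : R)) c ∈ N :=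
    transvection_mem_of_form_eq_one' h (by rw [form_single_inr, Pi.single_eq_same])
  by_cases hi : i = i₀
  · rw [hi]
    exact h₀ c
  have h₁ : ∀ c, transvection (Pi.single (Sum.inl i₀) (1 : R) + Pi.single (Sum.inl i) 1) c ∈ N :=
    transvection_mem_of_form_eq_one h₀ (by
      rw [form_single_inr]
      simp [Ne.symm hi])
  refine transvection_mem_of_form_eq_one' h₁ ?_ c
  rw [form_single_inr]
  simp [hi]

/-- A normal subgroup of `Sp(ℤ/l)` that contains the transvections along one vector of the
standard symplectic basis is the whole group. -/
theorem normal_eq_top_of_transvection_mem {l : ℕ} [NeZero l]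
    {N : Subgroup (symplecticGroup n (ZMod l))} [N.Normal] {i₀ : n}
    (hN : ∀ c, transvection (Pi.single (Sum.inl i₀) (1 : ZMod l)) c ∈ N) : N = ⊤ := by
  -- Induction on the set of basis pairs that `A` may move: an element of `N` restores one pair
  -- without disturbing those already fixed.
  suffices H : ∀ s : Finset n, ∀ A : symplecticGroup n (ZMod l),
      (∀ i ∉ s, A.1 *ᵥ Pi.single (Sum.inl i) 1 = Pi.single (Sum.inl i) 1 ∧
        A.1 *ᵥ Pi.single (Sum.inr i) 1 = Pi.single (Sum.inr i) 1) → A ∈ N from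
    Subgroup.eq_top_iff' N |>.mpr fun A => H Finset.univ A fun i hi =>
      absurd (Finset.mem_univ i) hi
  intro s
  induction s using Finset.induction_on with
  | empty =>
    intro A hA
    have : A = 1 := Subtype.ext (Matrix.ext_of_mulVec_single fun i => by
      rcases i with i | i
      · exact (hA i (Finset.notMem_empty i)).1.trans (one_mulVec' _).symm
      · exact (hA i (Finset.notMem_empty i)).2.trans (one_mulVec' _).symm)
    rw [this]
    exact N.one_mem
  | insert j s hj ih =>
    intro A hA
    let W : Set (n ⊕ n → ZMod l) := {z | ∃ i ∉ insert j s,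
      z = Pi.single (Sum.inl i) 1 ∨ z = Pi.single (Sum.inr i) 1}
    have hAW : ∀ z ∈ W, A.1 *ᵥ z = z := by
      rintro z ⟨i, hi, rfl | rfl⟩
      · exact (hA i hi).1
      · exact (hA i hi).2
    have hne : ∀ i ∉ insert j s, i ≠ j := fun i hi h => hi (h ▸ Finset.mem_insert_self j s)
    have hW₁ : ∀ z ∈ W, form (Pi.single (Sum.inr j) 1) z = 0 := by
      rintro z ⟨i, hi, rfl | rfl⟩ <;> rw [form_single_inr] <;> simp [(hne i hi).symm]
    have hW₂ : ∀ z ∈ W, form (Pi.single (Sum.inl j) 1) z = 0 := by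
      rintro z ⟨i, hi, rfl | rfl⟩ <;> rw [form_single_inl] <;> simp [(hne i hi).symm]
    have hpair : form (Pi.single (Sum.inr j) 1) (Pi.single (Sum.inl j) (1 : ZMod l)) = 1 := by
      rw [form_single_inr, Pi.single_eq_same]
    obtain ⟨h, hhN, hhW, hhf, hhe⟩ := exists_mem_mulVec_eq (W := W)
      (transvection_single_inr_mem hN j) hpair
      (v := A.1 *ᵥ Pi.single (Sum.inr j) 1) (w := A.1 *ᵥ Pi.single (Sum.inl j) 1)
      (by rw [form_mulVec, hpair]) hW₁ hW₂
      (fun z hz => by rw [← hAW z hz, form_mulVec, hW₁ z hz])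
      (fun z hz => by rw [← hAW z hz, form_mulVec, hW₂ z hz])
    refine (N.mul_mem_cancel_left hhN).mp (ih (h * A) fun i hi => ?_)
    by_cases hij : i = j
    · subst hij
      exact ⟨by rw [mul_mulVec, hhe], by rw [mul_mulVec, hhf]⟩
    · have hi' : i ∉ insert j s := by simp [hij, hi]
      have hl : Pi.single (Sum.inl i) 1 ∈ W := ⟨i, hi', Or.inl rfl⟩
      have hr : Pi.single (Sum.inr i) 1 ∈ W := ⟨i, hi', Or.inr rfl⟩
      exact ⟨by rw [mul_mulVec, hAW _ hl, hhW _ hl], by rw [mul_mulVec, hAW _ hr, hhW _ hr]⟩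

end SymplecticGroup

/-! ### Killing a transvection in a representation -/

namespace SymplecticGroup

open Matrix

variable {n R A : Type*} [Fintype n] [CommRing R] [DecidableEq n] [Ring A]

/-- A shear that fixes `c` and carries `a` to `a + c`. -/
theorem exists_mulVec_eq_add {a c d : n ⊕ n → R} (hac : form a c = 0) (hda : form d a = 1)
    (hdc : form d c = 0) :
    ∃ g : symplecticGroup n R, g.1 *ᵥ a = a + c ∧ g.1 *ᵥ c = c := by
  have hca : form c a = 0 := by rw [form_swap, hac, neg_zero]
  -- As `ω(d, c) = 0`, this is `x ↦ x + ω(c, x) (c + d) + ω(d, x) c`.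
  refine ⟨transvection d (-1) * transvection (c + d) 1, ?_, ?_⟩
  · simp only [mul_mulVec, transvection_mulVec, form_add_left, form_add_right, form_smul_right,
      hca, hda, hdc, form_self]
    module
  · simp only [mul_mulVec, transvection_mulVec, form_add_left, form_add_right, form_smul_right,
      hdc, form_self]
    module

/-- Both factors are conjugated by `φ g`, so the vanishing depends only on the orbit of the pair
`(a, c)`. -/
theorem map_transvection_mul_eq_zero_of_mulVec (φ : symplecticGroup n R →* A)
    {a c : n ⊕ n → R} (h : (φ (transvection a 1) - 1) * (φ (transvection c 1) - 1) = 0)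
    (g : symplecticGroup n R) :
    (φ (transvection (g.1 *ᵥ a) 1) - 1) * (φ (transvection (g.1 *ᵥ c) 1) - 1) = 0 := by
  have hg : φ g⁻¹ * φ g = 1 := by rw [← map_mul, inv_mul_cancel, map_one]
  have hg' : φ g * φ g⁻¹ = 1 := by rw [← map_mul, mul_inv_cancel, map_one]
  have key : ∀ v, φ (transvection (g.1 *ᵥ v) 1) - 1 =
      φ g * (φ (transvection v 1) - 1) * φ g⁻¹ := by
    intro v
    rw [← transvection_conj, map_mul, map_mul, mul_sub, mul_one, sub_mul, hg']
  calc _ = φ g * (φ (transvection a 1) - 1) * (φ g⁻¹ * φ g) * (φ (transvection c 1) - 1)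
        * φ g⁻¹ := by simp only [key, mul_assoc]
    _ = φ g * ((φ (transvection a 1) - 1) * (φ (transvection c 1) - 1)) * φ g⁻¹ := by
        rw [hg, mul_one, mul_assoc (φ g)]
    _ = 0 := by rw [h, mul_zero, zero_mul]

/-- Let `a`, `b`, `c` be pairwise orthogonal vectors such that each of `a`, `b`, `a + b` has a
dual vector orthogonal to `c`. If in a representation of the symplectic group the transvection
along `c` minus one is annihilated by those along `a`, `b`, `a + b`, then it vanishes. -/
theorem map_transvection_eq_one {k : Type*} [Field k] [CharZero k] [Algebra k A]
    [Finite (symplecticGroup n R)] (φ : symplecticGroup n R →* A) {a b c a' b' d' : n ⊕ n → R}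
    (hab : form a b = 0) (hac : form a c = 0) (hbc : form b c = 0)
    (haa : form a' a = 1) (hbb : form b' b = 1) (hdd : form d' (a + b) = 1)
    (hac' : form a' c = 0) (hbc' : form b' c = 0) (hdc' : form d' c = 0)
    (ha : (φ (transvection a 1) - 1) * (φ (transvection c 1) - 1) = 0)
    (hb : (φ (transvection b 1) - 1) * (φ (transvection c 1) - 1) = 0)
    (hd : (φ (transvection (a + b) 1) - 1) * (φ (transvection c 1) - 1) = 0) :
    φ (transvection c 1) = 1 := by
  have shear : ∀ {x y : n ⊕ n → R}, form x c = 0 → form y x = 1 → form y c = 0 →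
      (φ (transvection x 1) - 1) * (φ (transvection c 1) - 1) = 0 →
      (φ (transvection (x + c) 1) - 1) * (φ (transvection c 1) - 1) = 0 := by
    intro x y hxc hyx hyc h
    obtain ⟨g, hgx, hgc⟩ := exists_mulVec_eq_add hxc hyx hyc
    have := map_transvection_mul_eq_zero_of_mulVec φ h g
    rwa [hgx, hgc] at this
  have ha₁ := shear hac haa hac' ha
  have hb₁ := shear hbc hbb hbc' hb
  have hd₁ := shear (by rw [form_add_left, hac, hbc, add_zero]) hdd hdc' hd
  set X := φ (transvection c 1) - 1 with hX
  have absorb : ∀ {y : A}, (y - 1) * X = 0 → y * X = X := fun {y} h => by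
    rwa [sub_mul, one_mul, sub_eq_zero] at h
  have hrel := congrArg (fun g => φ g * X) (transvection_relation hab hac hbc)
  have hcX : φ (transvection c 1) * X = X * φ (transvection c 1) := by
    rw [hX, mul_sub, sub_mul, one_mul, mul_one]
  -- Every factor except `T_c` is absorbed by `X`; moving `T_c` to the right of `X` first leaves `X
  -- * φ (transvection c 1) = X`.
  simp only [map_mul, mul_assoc, absorb hb₁, absorb ha₁, absorb hd, hcX] at hrel
  rw [← mul_assoc (φ (transvection b 1)), absorb hb, ← mul_assoc (φ (transvection a 1)),
    absorb ha, ← mul_assoc, absorb hd₁] at hrel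
  refine eq_one_of_sub_one_mul_self_eq_zero (k := k)
    (Nat.card_pos (α := symplecticGroup n R)).ne' ?_ ?_
  · rw [← map_pow, pow_card_eq_one', map_one]
  · rw [← hX]
    nth_rewrite 2 [hX]
    rw [mul_sub, hrel, mul_one, sub_self]

end SymplecticGroup

/-! ### The block-diagonal subgroup -/

namespace SpProd

open Matrix SymplecticGroup

variable {R : Type*} {m n : ℕ}

/-- The vector with components `x` and `y` in the decomposition of `R ^ (2 (m + n))`. -/
def glue (x : Fin m ⊕ Fin m → R) (y : Fin n ⊕ Fin n → R) : Fin (m + n) ⊕ Fin (m + n) → R :=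
  Sum.elim x y ∘ (indexEquiv m n).symm

theorem exists_eq_glue (z : Fin (m + n) ⊕ Fin (m + n) → R) :
    ∃ (x : Fin m ⊕ Fin m → R) (y : Fin n ⊕ Fin n → R), z = glue x y :=
  ⟨(z ∘ indexEquiv m n) ∘ Sum.inl, (z ∘ indexEquiv m n) ∘ Sum.inr, by
    rw [glue, Sum.elim_comp_inl_inr, Function.comp_assoc, Equiv.self_comp_symm,
      Function.comp_id]⟩

variable [CommRing R]

theorem embedding_mulVec_glue (p : symplecticGroup (Fin m) R × symplecticGroup (Fin n) R)
    (x : Fin m ⊕ Fin m → R) (y : Fin n ⊕ Fin n → R) :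
    (embedding R m n p).1 *ᵥ glue x y = glue (p.1.1 *ᵥ x) (p.2.1 *ᵥ y) := by
  change blockSum p.1.1 p.2.1 *ᵥ glue x y = _
  rw [blockSum, reindex_apply, submatrix_mulVec_equiv, glue, Function.comp_assoc,
    Equiv.symm_symm, Equiv.symm_comp_self, Function.comp_id, fromBlocks_mulVec, glue]
  simp

theorem glue_add (x x' : Fin m ⊕ Fin m → R) (y y' : Fin n ⊕ Fin n → R) :
    glue (x + x') (y + y') = glue x y + glue x' y' := by
  funext i
  obtain ⟨i, rfl⟩ := (indexEquiv m n).surjective i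
  rcases i with i | i <;> simp [glue]

theorem glue_smul (c : R) (x : Fin m ⊕ Fin m → R) (y : Fin n ⊕ Fin n → R) :
    glue (c • x) (c • y) = c • glue x y := by
  funext i
  obtain ⟨i, rfl⟩ := (indexEquiv m n).surjective i
  rcases i with i | i <;> simp [glue]

theorem form_glue (x x' : Fin m ⊕ Fin m → R) (y y' : Fin n ⊕ Fin n → R) :
    form (glue x y) (glue x' y') = form x x' + form y y' := by
  rw [form, Fin.sum_univ_add, form, form]
  simp [glue, indexEquiv]

theorem embedding_transvection_left (x : Fin m ⊕ Fin m → R) (c : R) :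
    embedding R m n (transvection x c, 1) = transvection (glue x 0) c := by
  refine ext_mulVec fun z => ?_
  obtain ⟨x', y', rfl⟩ := exists_eq_glue z
  rw [embedding_mulVec_glue, transvection_mulVec, transvection_mulVec, form_glue, one_mulVec',
    ← glue_smul, ← glue_add, smul_zero, add_zero]
  simp [form]

theorem embedding_transvection_right (y : Fin n ⊕ Fin n → R) (c : R) :
    embedding R m n (1, transvection y c) = transvection (glue 0 y) c := by
  refine ext_mulVec fun z => ?_
  obtain ⟨x', y', rfl⟩ := exists_eq_glue z
  rw [embedding_mulVec_glue, transvection_mulVec, transvection_mulVec, form_glue, one_mulVec',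
    ← glue_smul, ← glue_add, smul_zero, add_zero]
  simp [form]

theorem glue_single_inl_zero (i : Fin m) :
    glue (Pi.single (Sum.inl i) (1 : R)) (0 : Fin n ⊕ Fin n → R) =
      Pi.single (Sum.inl (Fin.castAdd n i)) 1 := by
  funext j
  obtain ⟨j, rfl⟩ := (indexEquiv m n).surjective j
  have h : (Sum.inl (Fin.castAdd n i) : Fin (m + n) ⊕ Fin (m + n)) =
      indexEquiv m n (Sum.inl (Sum.inl i)) := by simp [indexEquiv]
  rw [h, Pi.single_apply, glue, Function.comp_apply, Equiv.symm_apply_apply]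
  simp only [EmbeddingLike.apply_eq_iff_eq]
  rcases j with j | j <;> simp [Pi.single_apply]

/-- If the restriction of a representation of `Sp_{2(m+n)}(ℤ/l)` to `Sp_{2m} × Sp_{2n}` is not
mixed, then the representation is trivial. -/
theorem ker_eq_top_of_not_isMixed {l : ℕ} [NeZero l] (hm : 1 ≤ m) (hn : 2 ≤ n)
    {k V : Type*} [Field k] [CharZero k] [AddCommGroup V] [Module k V]
    (ρ : Representation k (symplecticGroup (Fin (m + n)) (ZMod l)) V)
    (h : ¬ Representation.IsMixed (ρ.comp (embedding (ZMod l) m n))) :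
    MonoidHom.ker ρ = ⊤ := by
  have hann : ∀ (x : Fin m ⊕ Fin m → ZMod l) (y : Fin n ⊕ Fin n → ZMod l),
      (ρ (transvection (glue 0 y) 1) - 1) * (ρ (transvection (glue x 0) 1) - 1) = 0 := by
    intro x y
    have h₁ := Representation.sub_one_mul_sub_one_eq_zero_of_not_isMixed h
      (transvection x 1) (transvection y 1)
    have hcomm : Commute (ρ.comp (embedding (ZMod l) m n) (transvection x 1, 1))
        (ρ.comp (embedding (ZMod l) m n) (1, transvection y 1)) := by
      rw [commute_iff_eq, ← map_mul, ← map_mul, Prod.mk_mul_mk, Prod.mk_mul_mk]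
      simp only [mul_one, one_mul]
    rw [((hcomm.sub_left (Commute.one_left _)).sub_right (Commute.one_right _)).eq] at h₁
    rwa [MonoidHom.comp_apply, MonoidHom.comp_apply, embedding_transvection_left,
      embedding_transvection_right] at h₁
  let i₀ : Fin m := ⟨0, hm⟩
  let i₁ : Fin n := ⟨0, by lia⟩
  let i₂ : Fin n := ⟨1, by lia⟩
  have h12 : i₁ ≠ i₂ := by simp [i₁, i₂]
  have hform : ∀ (x : Fin m ⊕ Fin m → ZMod l) (y : Fin n ⊕ Fin n → ZMod l),
      form (glue 0 y) (glue x 0) = 0 := by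
    intro x y
    rw [form_glue]
    simp [form]
  have hform' : ∀ y y' : Fin n ⊕ Fin n → ZMod l,
      form (glue (0 : Fin m ⊕ Fin m → ZMod l) y) (glue 0 y') = form y y' := by
    intro y y'
    rw [form_glue]
    simp [form]
  have hsum : ∀ y y' : Fin n ⊕ Fin n → ZMod l,
      glue (0 : Fin m ⊕ Fin m → ZMod l) y + glue 0 y' = glue 0 (y + y') := by
    intro y y'
    rw [← glue_add, add_zero]
  have hone : ρ (transvection (glue (Pi.single (Sum.inl i₀) 1) 0) 1) = 1 := by
    -- Two orthogonal basis vectors of the second block, with their duals, are available because `2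
    -- ≤ n`. The dual of the first also serves for the sum.
    refine map_transvection_eq_one (k := k) ρ
      (a := glue 0 (Pi.single (Sum.inl i₁) 1)) (b := glue 0 (Pi.single (Sum.inl i₂) 1))
      (a' := glue 0 (Pi.single (Sum.inr i₁) 1)) (b' := glue 0 (Pi.single (Sum.inr i₂) 1))
      (d' := glue 0 (Pi.single (Sum.inr i₁) 1)) ?_ (hform _ _) (hform _ _) ?_ ?_ ?_
      (hform _ _) (hform _ _) (hform _ _) (hann _ _) (hann _ _) ?_
    · rw [hform', form_single_inl]
      simp
    · rw [hform', form_single_inr, Pi.single_eq_same]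
    · rw [hform', form_single_inr, Pi.single_eq_same]
    · rw [hsum, hform', form_single_inr]
      simp [h12]
    · rw [hsum]
      exact hann _ _
  rw [glue_single_inl_zero] at hone
  refine normal_eq_top_of_transvection_mem (i₀ := Fin.castAdd n i₀) fun c => ?_
  -- Over `ℤ/l` every transvection along a vector is a power of the one with coefficient `1`.
  rw [MonoidHom.mem_ker, ← ZMod.natCast_zmod_val c, transvection_natCast, map_pow, hone, one_pow]

end SpProd

theorem proposition4p7 (l g₁ g₂ : ℕ) (hl : 2 ≤ l) (hg₁ : 2 ≤ g₁) (hg₂ : 2 ≤ g₂) :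
    IsUniversallyMixed.{u, v} (SpProd.embedding (ZMod l) g₁ g₂)
      (SpProd.embedding_injective (ZMod l) g₁ g₂) ∧
    ∀ (k : Type u) [Field k] [CharZero k] (V : Type v) [AddCommGroup V] [Module k V]
      (ρ : Representation k (Matrix.symplecticGroup (Fin (g₁ + g₂)) (ZMod l)) V),
      Representation.IsMixed (ρ.comp (SpProd.embedding (ZMod l) g₁ g₂)) ∨
        Representation.IsTrivial (ρ.comp (SpProd.embedding (ZMod l) g₁ g₂)) := by
  have : NeZero l := ⟨by lia⟩
  have main : ∀ (k : Type u) [Field k] [CharZero k] (V : Type v) [AddCommGroup V] [Module k V]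
      (ρ : Representation k (Matrix.symplecticGroup (Fin (g₁ + g₂)) (ZMod l)) V),
      Representation.IsMixed (ρ.comp (SpProd.embedding (ZMod l) g₁ g₂)) ∨
        Representation.IsTrivial (ρ.comp (SpProd.embedding (ZMod l) g₁ g₂)) := by
    intro k _ _ V _ _ ρ
    refine or_iff_not_imp_left.mpr fun h => ⟨fun g => ?_⟩
    have hker := SpProd.ker_eq_top_of_not_isMixed (by lia) hg₂ ρ h
    have hg : SpProd.embedding (ZMod l) g₁ g₂ g ∈ MonoidHom.ker ρ := hker ▸ Subgroup.mem_top _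
    exact hg
  exact ⟨fun k _ _ _ V _ _ ρ => main k V ρ, main⟩
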